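/- Let $k\ge 2$ and let $p=(p_1,\dots,p_k)\in(0,1)^k$ with $\sum_{i=1}^k p_i=1$. Let $\Omega_1,\dots,\Omega_k$ be pairwise disjoint measurable subsets of a measurable space. For sample sizes $n$ and $m$, let $X_1,\dots,X_{n+m}$ be iid random variables with values in this space such that $\mathbb P(X_j\in\Omega_i)=p_i$ for all $j\in\{1,\dots,n+m\}$ and $i\in\{1,\dots,k\}$. Define the empirical probabilities $$\widehat p_{n,i}=\frac1n\sum_{j=1}^{n}\mathbf 1_{X_j\in\Omega_i},\qquad \widehat q_{m,i}=\frac1m\sum_{j=n+1}^{n+m}\mathbf 1_{X_j\in\Omega_i},\qquad i=1,\dots,k,$$ and the relative entropy $$D_{\mathrm{KL}}(\widehat p_n\Vert\widehat q_m)=\sum_{i=1}^k\widehat p_{n,i}\log\frac{\widehat p_{n,i}}{\widehat q_{m,i}}\in[0,+\infty],$$ where a term with $\widehat p_{n,i}=0$ is $0$ and a term with $\widehat p_{n,i}>0=\widehat q_{m,i}$ is $+\infty$. Then, when $n\to\infty$, $m\to\infty$ and $\frac{n}{n+m}\to\lambda$ for some $\lambda\in(0,1)$, $$2\,\frac{nm}{n+m}\,D_{\mathrm{KL}}(\widehat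 p_n\Vert\widehat q_m)\ \overset{\mathrm d}{\longrightarrow}\ \chi^2_{k-1},$$ where $\overset{\mathrm d}{\longrightarrow}$ stands for convergence in distribution (of random variables with values in the extended real line) and $\chi^2_{k-1}$ is the chi-squared distribution with $k-1$ degrees of freedom. -/

import Mathlib

open MeasureTheory ProbabilityTheory Filter
open scoped Topology

/-- The chi-squared distribution with `d` degrees of freedom: the law of the sum of the squares of
`d` independent standard Gaussian random variables. -/
noncomputable def chiSquared (d : ℕ) : Measure ℝ :=
  (Measure.pi (fun _ : Fin d ↦ gaussianReal 0 1)).map (fun z ↦ ∑ i, z i ^ 2)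

/-- The empirical probability vector of a sample `x 0, …, x (n - 1)` with respect to the states
`S a`, `a : Fin k`: its component `a` is the proportion of the observations that lie in `S a`. -/
noncomputable def empiricalProb {𝓧 : Type*} {k n : ℕ} (S : Fin k → Set 𝓧) (x : Fin n → 𝓧)
    (a : Fin k) : ℝ :=
  (1 / (n : ℝ)) * ∑ j, (S a).indicator (fun _ ↦ (1 : ℝ)) (x j)

open Classical in
/-- The term `a log (a / b)` of the relative entropy, for `a, b ≥ 0`, with the conventions
`0 log (0 / b) = 0` (also for `b = 0`) and `a log (a / 0) = +∞` for `a > 0`. -/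
noncomputable def relEntropyTerm (a b : ℝ) : EReal :=
  if a = 0 then 0 else if b = 0 then ⊤ else ((a * Real.log (a / b) : ℝ) : EReal)

/-- The relative entropy (Kullback-Leibler divergence) `D_KL(p ‖ q) = ∑ a, p a * log (p a / q a)` of
two probability vectors. It is infinite exactly when `p a ≠ 0` and `q a = 0` for some `a`. -/
noncomputable def relEntropy {k : ℕ} (p q : Fin k → ℝ) : EReal :=
  ∑ a, relEntropyTerm (p a) (q a)

/-- The two-sample statistic `2 * (n m / (n + m)) * D_KL(p̂ ‖ q̂)` of the observations
`x 0, …, x (n + m - 1)`, where `p̂` is the empirical probability of the first `n` observations and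
`q̂` the one of the last `m` observations. -/
noncomputable def twoSampleStat {𝓧 : Type*} {k : ℕ} (S : Fin k → Set 𝓧) (n m : ℕ)
    (x : Fin (n + m) → 𝓧) : EReal :=
  ((2 * ((n : ℝ) * (m : ℝ) / ((n : ℝ) + (m : ℝ))) : ℝ) : EReal) *
    relEntropy (empiricalProb S (fun j : Fin n ↦ x (Fin.castAdd m j)))
      (empiricalProb S (fun j : Fin m ↦ x (Fin.natAdd n j)))

/-! Write `P`, `Q` for the two empirical vectors. The states cover almost every observation, so both
vectors sum to one and `D_KL(P ‖ Q) = ∑ (P a log (P a / Q a) - P a + Q a)` whenever no `Q a`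
vanishes. Each corrected summand is quadratic in `P a - Q a`: it equals `(P a - Q a)² / (2 p a)`
times a ratio that depends continuously on `(P a, Q a)` and is `1` at `(p a, p a)`. The statistic is
therefore `∑ (W a)² R a`, with `W` the standardised difference of `P` and `Q`
(`twoSampleStat_eq_sum`), outside an event of vanishing probability, which absorbs the infinite
values.

By the weak law of large numbers `R → 1` in probability (`tendsto_measure_norm_stateRatio_sub_one`).
The vector `W` is a weighted sum of independent centred vectors with covariance `I - e eᵀ`, where `e
= (√(p a))` is a unit vector. Its characteristic function is a product of an `n`-th and an `m`-th
power, whose limits carry the shares `1 - lam` and `lam` of that covariance. Hence `W` converges to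
the standard Gaussian on the hyperplane `eᗮ` (`tendstoInDistribution_standardisedDiff`). Slutsky's
theorem then gives the squared norm of a standard Gaussian in dimension `k - 1`. -/

/-! ### Second order expansions -/

/-- The second order difference quotient of `r ↦ r log r - r + 1` at its minimum `r = 1`. -/
noncomputable def entropyQuotient (r : ℝ) : ℝ :=
  if r = 1 then 1 / 2 else (r * Real.log r - r + 1) / (r - 1) ^ 2

lemma mul_log_sub_add_one_eq (r : ℝ) :
    r * Real.log r - r + 1 = (r - 1) ^ 2 * entropyQuotient r := by
  unfold entropyQuotient
  split_ifs with h
  · simp [h]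
  · have : r - 1 ≠ 0 := sub_ne_zero.2 h
    field_simp

lemma abs_entropyQuotient_sub_half_le {u : ℝ} (hu : |u| ≤ 1 / 2) :
    |entropyQuotient (1 + u) - 1 / 2| ≤ 4 * |u| := by
  rcases eq_or_ne u 0 with rfl | h0
  · simp [entropyQuotient]
  have hu2 : 0 < |u| := abs_pos.2 h0
  -- The bound concerns `log (1 - x)`, hence `x = -u`; two terms leave a cubic remainder.
  have h := Real.abs_log_sub_add_sum_range_le (x := -u) (by rw [abs_neg]; linarith) 2
  simp only [Finset.sum_range_succ, Finset.sum_range_zero, abs_neg, sub_neg_eq_add] at h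
  set e := Real.log (1 + u) with he
  have h1 : |e - u + u ^ 2 / 2| ≤ 2 * |u| ^ 3 := by
    have h2 : |u| ^ (2 + 1) / (1 - |u|) ≤ 2 * |u| ^ 3 := by
      rw [div_le_iff₀ (by linarith)]
      have : 0 < |u| ^ 3 := by positivity
      have h4 := mul_nonneg this.le (sub_nonneg.2 hu)
      calc |u| ^ (2 + 1) = |u| ^ 3 := by norm_num
        _ ≤ 2 * |u| ^ 3 * (1 - |u|) := by linarith
    refine le_trans (le_of_eq ?_) (h.trans h2)
    congr 1
    push_cast
    ring
  have hne : 1 + u ≠ 1 := by simpa using h0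
  -- Since `(1 + u) (u - u² / 2) = u + u² / 2 - u³ / 2`, the numerator reduces to the logarithm's
  -- remainder and one cubic term. The resulting constant `3 / 2 * 2 + 1 / 2` is rounded up to `4`.
  have key : entropyQuotient (1 + u) - 1 / 2
      = ((1 + u) * (e - u + u ^ 2 / 2) - u ^ 3 / 2) / u ^ 2 := by
    rw [entropyQuotient, if_neg hne, ← he]
    field_simp
    ring
  rw [key, abs_div, abs_of_nonneg (sq_nonneg u), div_le_iff₀ (by positivity)]
  have h3 : |1 + u| ≤ 3 / 2 := by
    have := abs_le.1 hu
    rw [abs_le]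
    constructor <;> linarith
  calc |(1 + u) * (e - u + u ^ 2 / 2) - u ^ 3 / 2|
      ≤ |(1 + u) * (e - u + u ^ 2 / 2)| + |u ^ 3 / 2| := abs_sub _ _
    _ = |1 + u| * |e - u + u ^ 2 / 2| + |u| ^ 3 / 2 := by
        rw [abs_mul, abs_div, abs_pow]
        simp
    _ ≤ 3 / 2 * (2 * |u| ^ 3) + |u| ^ 3 / 2 := by gcongr
    _ ≤ 4 * |u| ^ 3 := by nlinarith [pow_pos hu2 3]
    _ = 4 * |u| * u ^ 2 := by rw [← sq_abs u]; ring

lemma continuousAt_entropyQuotient : ContinuousAt entropyQuotient 1 := by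
  have h1 : entropyQuotient 1 = 1 / 2 := by simp [entropyQuotient]
  rw [ContinuousAt, h1, tendsto_iff_norm_sub_tendsto_zero]
  have hlim : Tendsto (fun r : ℝ ↦ 4 * |r - 1|) (𝓝 1) (𝓝 0) := by
    have : Continuous fun r : ℝ ↦ 4 * |r - 1| := by fun_prop
    simpa using this.tendsto 1
  refine squeeze_zero' (.of_forall fun _ ↦ norm_nonneg _) ?_ hlim
  filter_upwards [Metric.closedBall_mem_nhds (1 : ℝ) (by norm_num : (0 : ℝ) < 1 / 2)] with r hr
  rw [Metric.mem_closedBall, Real.dist_eq] at hr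
  simpa using abs_entropyQuotient_sub_half_le hr

/-- The ratio between the relative entropy term `x log (x / y) - x + y` and `(x - y) ^ 2 / (2 r)`. -/
noncomputable def entropyRatio (r : ℝ) (z : ℝ × ℝ) : ℝ :=
  2 * r / z.2 * entropyQuotient (z.1 / z.2)

/-- The correction `-x + y` removes the linear part at `x = y` and cancels when summed over two
probability vectors. The case `x = 0` is included, because `0 * log 0 = 0`. -/
lemma mul_log_div_sub_add_eq (x : ℝ) {r y : ℝ} (hr : r ≠ 0) (hy : y ≠ 0) :
    2 * (x * Real.log (x / y) - x + y) = (x - y) ^ 2 / r * entropyRatio r (x, y) := by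
  have h := mul_log_sub_add_one_eq (x / y)
  have h2 : x * Real.log (x / y) - x + y = y * (x / y * Real.log (x / y) - x / y + 1) := by
    field_simp
  rw [h2, h, entropyRatio]
  field_simp

lemma entropyRatio_self {r : ℝ} (hr : r ≠ 0) : entropyRatio r (r, r) = 1 := by
  simp [entropyRatio, entropyQuotient, hr]

lemma continuousAt_entropyRatio {r : ℝ} (hr : r ≠ 0) : ContinuousAt (entropyRatio r) (r, r) := by
  have h : ContinuousAt (fun z : ℝ × ℝ ↦ z.1 / z.2) (r, r) :=
    continuousAt_fst.div continuousAt_snd hr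
  refine (continuousAt_const.div continuousAt_snd hr).mul ?_
  refine ContinuousAt.comp_of_eq continuousAt_entropyQuotient h (div_self hr)

lemma measurable_entropyRatio (r : ℝ) : Measurable (entropyRatio r) := by
  have : Measurable entropyQuotient := by
    refine Measurable.ite (measurableSet_singleton 1) measurable_const ?_
    fun_prop
  unfold entropyRatio
  fun_prop

/-! ### Limits of powers of characteristic functions. -/

/-- If `N t * z t → a` and `z t → 0`, then `(1 + z t) ^ N t → exp a`. -/
lemma Complex.tendsto_one_add_pow_exp {ι : Type*} {l : Filter ι} {N : ι → ℕ} {z : ι → ℂ} {a : ℂ}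
    (hz : Tendsto z l (𝓝 0)) (hNz : Tendsto (fun t ↦ (N t : ℂ) * z t) l (𝓝 a)) :
    Tendsto (fun t ↦ (1 + z t) ^ N t) l (𝓝 (Complex.exp a)) := by
  have hsmall : ∀ᶠ t in l, ‖z t‖ < 1 / 2 := by
    filter_upwards [hz.norm.eventually_lt_const (by simp : ‖(0 : ℂ)‖ < 1 / 2)] with t ht using ht
  -- `log (1 + z) - z` is `O(z²)`, so `N` times it is bounded by `|N z| |z|`, a convergent factor
  -- times a vanishing one.
  have hrem : Tendsto (fun t ↦ (N t : ℂ) * (Complex.log (1 + z t) - z t)) l (𝓝 0) := by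
    rw [tendsto_zero_iff_norm_tendsto_zero]
    have hlim : Tendsto (fun t ↦ ‖(N t : ℂ) * z t‖ * ‖z t‖) l (𝓝 0) := by
      simpa using hNz.norm.mul hz.norm
    refine squeeze_zero' (.of_forall fun _ ↦ norm_nonneg _) ?_ hlim
    filter_upwards [hsmall] with t ht
    have h := Complex.norm_log_one_add_sub_self_le (z := z t) (by linarith)
    rw [norm_mul, norm_mul, mul_assoc]
    gcongr
    refine h.trans ?_
    have h2 : (1 - ‖z t‖)⁻¹ ≤ 2 := by
      rw [inv_le_comm₀ (by linarith) (by norm_num)]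
      linarith
    nlinarith [sq_nonneg ‖z t‖]
  have hlog : Tendsto (fun t ↦ (N t : ℂ) * Complex.log (1 + z t)) l (𝓝 a) := by
    have := hrem.add hNz
    simp only [zero_add] at this
    refine this.congr fun t ↦ ?_
    ring
  refine ((Complex.continuous_exp.tendsto a).comp hlog).congr' ?_
  filter_upwards [hsmall] with t ht
  have hne : 1 + z t ≠ 0 := by
    intro h
    have : z t = -1 := by linear_combination h
    rw [this] at ht
    norm_num at ht
  rw [Function.comp_apply, Complex.exp_nat_mul, Complex.exp_log hne]

/-- Second order expansion of the characteristic function of a centred distribution with finite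
support. -/
lemma tendsto_sum_exp_sub_one_div_sq {κ : Type*} [Fintype κ] {p b : κ → ℝ}
    (hp : ∑ a, p a = 1) (hb : ∑ a, p a * b a = 0) :
    Tendsto (fun u : ℝ ↦ (∑ a, (p a : ℂ) * Complex.exp ((u * b a : ℝ) * Complex.I) - 1) / (u : ℂ) ^ 2)
      (𝓝[≠] 0) (𝓝 (-((∑ a, p a * b a ^ 2 : ℝ) : ℂ) / 2)) := by
  have hterm (c : ℝ) : Tendsto
      (fun u : ℝ ↦ (Complex.exp ((u * c : ℝ) * Complex.I) - 1 - (u * c : ℝ) * Complex.I) / (u : ℂ) ^ 2)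
      (𝓝[≠] 0) (𝓝 (-(c : ℂ) ^ 2 / 2)) := by
    rw [tendsto_iff_norm_sub_tendsto_zero]
    have hlim : Tendsto (fun u : ℝ ↦ |u| * |c| ^ 3) (𝓝[≠] 0) (𝓝 0) := by
      have : Continuous fun u : ℝ ↦ |u| * |c| ^ 3 := by fun_prop
      simpa using (this.tendsto 0).mono_left nhdsWithin_le_nhds
    refine squeeze_zero' (.of_forall fun _ ↦ norm_nonneg _) ?_ hlim
    have hsm : ∀ᶠ u : ℝ in 𝓝[≠] 0, |u * c| < 1 := by
      have : Continuous fun u : ℝ ↦ |u * c| := by fun_prop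
      exact ((this.tendsto 0).mono_left nhdsWithin_le_nhds).eventually_lt_const (by simp)
    filter_upwards [hsm, self_mem_nhdsWithin] with u hu hu0
    have hu0 : (u : ℂ) ≠ 0 := by exact_mod_cast hu0
    have hnorm : ‖((u * c : ℝ) : ℂ) * Complex.I‖ = |u * c| := by
      rw [norm_mul, Complex.norm_I, mul_one, Complex.norm_real, Real.norm_eq_abs]
    have h := Complex.exp_bound (x := (u * c : ℝ) * Complex.I) (by rw [hnorm]; exact hu.le)
      (n := 3) (by norm_num)
    rw [hnorm] at h
    have hrw : (Complex.exp ((u * c : ℝ) * Complex.I) - 1 - (u * c : ℝ) * Complex.I) / (u : ℂ) ^ 2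
        - -(c : ℂ) ^ 2 / 2 = (Complex.exp ((u * c : ℝ) * Complex.I)
          - ∑ m ∈ Finset.range 3, ((u * c : ℝ) * Complex.I) ^ m / m.factorial) / (u : ℂ) ^ 2 := by
      simp only [Finset.sum_range_succ, Finset.sum_range_zero]
      field_simp
      simp [mul_pow, Complex.I_sq, Nat.factorial]
      ring
    have hu1 : 0 < |u| ^ 2 := by
      have : u ≠ 0 := by exact_mod_cast hu0
      positivity
    rw [hrw, norm_div, norm_pow, Complex.norm_real, Real.norm_eq_abs, div_le_iff₀ hu1]
    refine h.trans ?_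
    rw [abs_mul]
    have h1 : |u| * |c| ^ 3 * |u| ^ 2 = (|u| * |c|) ^ 3 := by ring
    have h2 : 0 ≤ (|u| * |c|) ^ 3 := by positivity
    rw [h1]
    norm_num [Nat.factorial]
    linarith
  -- Averaging with weights `p` turns the constant terms into `1` and, by centring, kills the linear
  -- ones.
  have hsum := tendsto_finsetSum (Finset.univ : Finset κ) fun a _ ↦ (hterm (b a)).const_mul (p a : ℂ)
  have hlim : (∑ a, (p a : ℂ) * (-(b a : ℂ) ^ 2 / 2)) = -((∑ a, p a * b a ^ 2 : ℝ) : ℂ) / 2 := by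
    push_cast
    rw [← Finset.sum_neg_distrib, Finset.sum_div]
    exact Finset.sum_congr rfl fun a _ ↦ by ring
  rw [hlim] at hsum
  refine hsum.congr fun u ↦ ?_
  have hp' : ∑ a, (p a : ℂ) = 1 := by exact_mod_cast hp
  have hb' : ∑ a, (p a : ℂ) * (b a : ℂ) = 0 := by exact_mod_cast hb
  simp_rw [← mul_div_assoc]
  rw [← Finset.sum_div]
  congr 1
  simp_rw [mul_sub, Finset.sum_sub_distrib, mul_one, hp']
  have : ∑ a, (p a : ℂ) * (((u * b a : ℝ) : ℂ) * Complex.I) = 0 := by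
    have h2 : ∑ a, (p a : ℂ) * (((u * b a : ℝ) : ℂ) * Complex.I)
        = (∑ a, (p a : ℂ) * (b a : ℂ)) * (u * Complex.I) := by
      rw [Finset.sum_mul]
      exact Finset.sum_congr rfl fun a _ ↦ by push_cast; ring
    rw [h2, hb', zero_mul]
  rw [this, sub_zero]

/-- The powers of the characteristic function of a centred distribution with finite support
converge to a Gaussian characteristic function. -/
lemma tendsto_sum_exp_pow {κ ι : Type*} [Fintype κ] {l : Filter ι} {p b : κ → ℝ}
    (hp : ∑ a, p a = 1) (hb : ∑ a, p a * b a = 0) {N : ι → ℕ} {u : ι → ℝ} {v : ℝ}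
    (hu : Tendsto u l (𝓝[≠] 0)) (hNu : Tendsto (fun t ↦ (N t : ℝ) * u t ^ 2) l (𝓝 v)) :
    Tendsto (fun t ↦ (∑ a, (p a : ℂ) * Complex.exp ((u t * b a : ℝ) * Complex.I)) ^ N t) l
      (𝓝 (Complex.exp (-(v * ∑ a, p a * b a ^ 2 : ℝ) / 2))) := by
  have hq := (tendsto_sum_exp_sub_one_div_sq hp hb).comp hu
  have hu' : Tendsto (fun t ↦ (u t : ℂ) ^ 2) l (𝓝 0) := by
    have h0 : Tendsto u l (𝓝 0) := hu.mono_right nhdsWithin_le_nhds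
    have := ((Complex.continuous_ofReal.tendsto 0).comp h0).pow 2
    simpa using this
  have hne : ∀ᶠ t in l, (u t : ℂ) ≠ 0 := by
    filter_upwards [hu self_mem_nhdsWithin] with t ht
    exact_mod_cast ht
  have hNu' : Tendsto (fun t ↦ (N t : ℂ) * (u t : ℂ) ^ 2) l (𝓝 (v : ℂ)) := by
    refine ((Complex.continuous_ofReal.tendsto v).comp hNu).congr fun t ↦ ?_
    simp
  set φ : ι → ℂ := fun t ↦ ∑ a, (p a : ℂ) * Complex.exp ((u t * b a : ℝ) * Complex.I)
  have h := Complex.tendsto_one_add_pow_exp (l := l) (N := N) (z := fun t ↦ φ t - 1)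
    (a := -(v * ∑ a, p a * b a ^ 2 : ℝ) / 2) ?_ ?_
  · simpa [φ] using h
  · have := hq.mul hu'
    rw [mul_zero] at this
    refine this.congr' ?_
    filter_upwards [hne] with t ht
    rw [Function.comp_apply, div_mul_cancel₀ _ (pow_ne_zero 2 ht)]
  · have := hNu'.mul hq
    have hlim : (v : ℂ) * (-((∑ a, p a * b a ^ 2 : ℝ) : ℂ) / 2)
        = -(v * ∑ a, p a * b a ^ 2 : ℝ) / 2 := by
      push_cast
      ring
    rw [hlim] at this
    refine this.congr' ?_
    filter_upwards [hne] with t ht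
    rw [Function.comp_apply, mul_assoc, mul_div_cancel₀ _ (pow_ne_zero 2 ht)]

/-! ### Convergence in distribution on varying probability spaces -/

section Distribution

variable {ι Ω' E : Type*} {Ω : ι → Type*} [mΩ : ∀ t, MeasurableSpace (Ω t)]
  {μ : (t : ι) → Measure (Ω t)} [∀ t, IsProbabilityMeasure (μ t)]
  [MeasurableSpace Ω'] {μ' : Measure Ω'} [IsProbabilityMeasure μ']
  [MeasurableSpace E] {l : Filter ι} {Z : Ω' → E}

/-- Convergence in distribution only depends on the laws: the random variables may be realised on
the product of all the probability spaces. -/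
lemma tendstoInDistribution_infinitePi_iff [TopologicalSpace E] [OpensMeasurableSpace E]
    {X : (t : ι) → Ω t → E} (hX : ∀ t, AEMeasurable (X t) (μ t)) :
    TendstoInDistribution (fun t (ω : (s : ι) → Ω s) ↦ X t (ω t)) l Z
        (fun _ ↦ Measure.infinitePi μ) μ' ↔ TendstoInDistribution X l Z μ μ' := by
  have hmap (t : ι) : (Measure.infinitePi μ).map (fun ω : (s : ι) → Ω s ↦ X t (ω t))
      = (μ t).map (X t) := by
    have hpres := measurePreserving_eval_infinitePi μ t
    have := AEMeasurable.map_map_of_aemeasurable (μ := Measure.infinitePi μ)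
      (f := Function.eval t) (g := X t) (by rw [hpres.map_eq]; exact hX t)
      hpres.measurable.aemeasurable
    rw [hpres.map_eq] at this
    exact this.symm
  have hmeas (t : ι) : AEMeasurable (fun ω : (s : ι) → Ω s ↦ X t (ω t)) (Measure.infinitePi μ) :=
    (hX t).comp_quasiMeasurePreserving (measurePreserving_eval_infinitePi μ t).quasiMeasurePreserving
  constructor
  · intro h
    refine ⟨hX, h.aemeasurable_limit, h.tendsto.congr fun t ↦ Subtype.ext (hmap t)⟩
  · intro h
    refine ⟨hmeas, h.aemeasurable_limit, h.tendsto.congr fun t ↦ Subtype.ext (hmap t).symm⟩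

/-- **Slutsky's theorem** on varying probability spaces. -/
lemma MeasureTheory.TendstoInDistribution.continuous_comp_prodMk_of_tendsto_const
    {E' F : Type*} [l.IsCountablyGenerated]
    [SeminormedAddCommGroup E] [SecondCountableTopology E] [BorelSpace E]
    [NormedAddCommGroup E'] [MeasurableSpace E'] [SecondCountableTopology E'] [BorelSpace E']
    [TopologicalSpace F] [MeasurableSpace F] [BorelSpace F] {g : E × E' → F} (hg : Continuous g)
    {X : (t : ι) → Ω t → E} {Y : (t : ι) → Ω t → E'} {c : E'}
    (hX : TendstoInDistribution X l Z μ μ') (hY : ∀ t, AEMeasurable (Y t) (μ t))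
    (hYc : ∀ ε > 0, Tendsto (fun t ↦ μ t {ω | ε ≤ ‖Y t ω - c‖}) l (𝓝 0)) :
    TendstoInDistribution (fun t ω ↦ g (X t ω, Y t ω)) l (fun ω ↦ g (Z ω, c)) μ μ' := by
  have hXm := hX.forall_aemeasurable
  refine (tendstoInDistribution_infinitePi_iff (X := fun t ω ↦ g (X t ω, Y t ω))
    fun t ↦ hg.measurable.comp_aemeasurable ((hXm t).prodMk (hY t))).1 ?_
  -- On the product space all the variables share one probability measure, so convergence in measure
  -- to `c` makes sense.
  refine TendstoInDistribution.continuous_comp_prodMk_of_tendstoInMeasure_const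
    (X := fun t (ω : (s : ι) → Ω s) ↦ X t (ω t)) (Y := fun t (ω : (s : ι) → Ω s) ↦ Y t (ω t)) hg
    ((tendstoInDistribution_infinitePi_iff hXm).2 hX) ?_ fun t ↦
      (hY t).comp_quasiMeasurePreserving
        (measurePreserving_eval_infinitePi μ t).quasiMeasurePreserving
  rw [tendstoInMeasure_iff_norm]
  intro ε hε
  refine (hYc ε hε).congr fun t ↦ ?_
  have hset : NullMeasurableSet {ω | ε ≤ ‖Y t ω - c‖} (μ t) :=
    nullMeasurableSet_le aemeasurable_const ((hY t).sub_const c).norm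
  exact ((measurePreserving_eval_infinitePi μ t).measure_preimage hset).symm

/-- Random variables that differ with vanishing probability have the same limit in
distribution. -/
lemma MeasureTheory.TendstoInDistribution.congr_of_tendsto_measure_ne [TopologicalSpace E]
    [OpensMeasurableSpace E] {X Y : (t : ι) → Ω t → E} (hX : TendstoInDistribution X l Z μ μ')
    (hY : ∀ t, AEMeasurable (Y t) (μ t))
    (hXY : Tendsto (fun t ↦ (μ t).real {ω | X t ω ≠ Y t ω}) l (𝓝 0)) :
    TendstoInDistribution Y l Z μ μ' := by
  refine ⟨hY, hX.aemeasurable_limit, ?_⟩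
  have hXm := hX.forall_aemeasurable
  have hlim := ProbabilityMeasure.tendsto_iff_forall_integral_tendsto.1 hX.tendsto
  refine ProbabilityMeasure.tendsto_iff_forall_integral_tendsto.2 fun f ↦ ?_
  have hf : Measurable f := f.continuous.measurable
  have h0 : Tendsto (fun t ↦ ∫ x, f x ∂(μ t).map (Y t) - ∫ x, f x ∂(μ t).map (X t)) l (𝓝 0) := by
    rw [tendsto_zero_iff_norm_tendsto_zero]
    have hb : Tendsto (fun t ↦ 2 * ‖f‖ * (μ t).real {ω | X t ω ≠ Y t ω}) l (𝓝 0) := by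
      simpa using hXY.const_mul (2 * ‖f‖)
    refine squeeze_zero (fun _ ↦ norm_nonneg _) (fun t ↦ ?_) hb
    rw [integral_map (hY t) hf.aestronglyMeasurable, integral_map (hXm t) hf.aestronglyMeasurable]
    have hint {W : Ω t → E} (hW : AEMeasurable W (μ t)) : Integrable (fun ω ↦ f (W ω)) (μ t) :=
      Integrable.of_bound (hf.comp_aemeasurable hW).aestronglyMeasurable ‖f‖
        (.of_forall fun _ ↦ f.norm_coe_le_norm _)
    rw [← integral_sub (hint (hY t)) (hint (hXm t))]
    -- The set where `X t` and `Y t` differ need not be measurable; its measurable hull has the same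
    -- measure.
    set s := toMeasurable (μ t) {ω | X t ω ≠ Y t ω}
    have hs : (μ t).real s = (μ t).real {ω | X t ω ≠ Y t ω} := by
      simp [s, measureReal_def, measure_toMeasurable]
    have hbound : ∀ ω, ‖f (Y t ω) - f (X t ω)‖ ≤ s.indicator (fun _ ↦ 2 * ‖f‖) ω := by
      intro ω
      by_cases hω : ω ∈ s
      · rw [Set.indicator_of_mem hω]
        refine (norm_sub_le _ _).trans ?_
        have h1 := f.norm_coe_le_norm (Y t ω)
        have h2 := f.norm_coe_le_norm (X t ω)
        linarith
      · have : X t ω = Y t ω := by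
          by_contra hne
          exact hω (subset_toMeasurable _ _ hne)
        simp [Set.indicator_of_notMem hω, this]
    have hsm : MeasurableSet s := measurableSet_toMeasurable _ _
    calc ‖∫ ω, (f (Y t ω) - f (X t ω)) ∂μ t‖
        ≤ ∫ ω, s.indicator (fun _ ↦ 2 * ‖f‖) ω ∂μ t :=
          norm_integral_le_of_norm_le ((integrable_const _).indicator hsm) (.of_forall hbound)
      _ = 2 * ‖f‖ * (μ t).real {ω | X t ω ≠ Y t ω} := by
          rw [integral_indicator hsm, setIntegral_const, hs, smul_eq_mul, mul_comm]
  have := (hlim f).add h0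
  simpa using this

end Distribution

/-! ### The chi-squared limit -/

section ChiSquared

variable {E : Type*} [NormedAddCommGroup E] [InnerProductSpace ℝ E] [FiniteDimensional ℝ E]
  [MeasurableSpace E] [BorelSpace E]

/-- The coordinates in an orthonormal basis are independent standard Gaussians, and Parseval gives
the norm. -/
lemma map_norm_sq_stdGaussian :
    (stdGaussian E).map (fun x ↦ ‖x‖ ^ 2) = chiSquared (Module.finrank ℝ E) := by
  have hnorm (z : Fin (Module.finrank ℝ E) → ℝ) :
      ‖∑ i, z i • stdOrthonormalBasis ℝ E i‖ ^ 2 = ∑ i, z i ^ 2 := by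
    rw [← (stdOrthonormalBasis ℝ E).sum_sq_inner_right]
    refine Finset.sum_congr rfl fun i _ ↦ ?_
    rw [(stdOrthonormalBasis ℝ E).orthonormal.inner_right_fintype]
  rw [stdGaussian, Measure.map_map (by fun_prop) (by fun_prop), chiSquared]
  congr 1
  ext z
  exact hnorm z

/-- For `x` in `K`, the inner product with `t` only sees the projection of `t` onto `K`. -/
lemma charFun_map_subtype_stdGaussian (K : Submodule ℝ E) (t : E) :
    charFun ((stdGaussian K).map (fun x : K ↦ (x : E))) t
      = Complex.exp (-‖K.orthogonalProjectionOnto t‖ ^ 2 / 2) := by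
  rw [charFun_apply, integral_map (by fun_prop) (by fun_prop), ← charFun_stdGaussian,
    charFun_apply]
  refine integral_congr_ae (.of_forall fun x ↦ ?_)
  simp only [K.inner_orthogonalProjectionOnto_eq_of_mem_left]

/-- For a unit vector `e`, the standard Gaussian of the hyperplane orthogonal to `e` has
characteristic function `exp (-(‖t‖² - ⟪e, t⟫²) / 2)`. -/
lemma charFun_map_subtype_stdGaussian_orthogonal {e : E} (he : ‖e‖ = 1) (t : E) :
    charFun ((stdGaussian (Submodule.span ℝ {e})ᗮ).map
      (fun x : (Submodule.span ℝ {e})ᗮ ↦ (x : E))) t = Complex.exp (-((‖t‖ ^ 2 - inner ℝ e t ^ 2 : ℝ) : ℂ) / 2) := by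
  rw [charFun_map_subtype_stdGaussian]
  have h := Submodule.norm_sq_eq_add_norm_sq_projection t (Submodule.span ℝ {e})
  have h2 : ‖(Submodule.span ℝ {e}).orthogonalProjectionOnto t‖ ^ 2 = inner ℝ e t ^ 2 := by
    change ‖((Submodule.span ℝ {e}).orthogonalProjectionOnto t : E)‖ ^ 2 = _
    rw [Submodule.coe_orthogonalProjectionOnto_apply,
      Submodule.starProjection_unit_singleton ℝ he, norm_smul, he, mul_one, Real.norm_eq_abs,
      sq_abs]
  rw [h2] at h
  rw [h, add_sub_cancel_left]
  push_cast
  rfl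

end ChiSquared

/-! ### Observations that fall into finitely many disjoint states -/

section Observation

variable {𝓧 Ω : Type*} [MeasurableSpace 𝓧] [MeasurableSpace Ω] {μ : Measure Ω}
  [IsProbabilityMeasure μ] {k : ℕ} {S : Fin k → Set 𝓧} {p : Fin k → ℝ} {x : Ω → 𝓧}

/-- The states need not cover `𝓧`, but they are disjoint and their probabilities already exhaust the
total mass. -/
lemma ae_exists_mem_state (hS : ∀ a, MeasurableSet (S a))
    (hSd : Pairwise (fun a b ↦ Disjoint (S a) (S b))) (hpsum : ∑ a, p a = 1)
    (hx : AEMeasurable x μ) (hxp : ∀ a, μ.real (x ⁻¹' S a) = p a) :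
    ∀ᵐ ω ∂μ, ∃ a, x ω ∈ S a := by
  have hnull (a : Fin k) : NullMeasurableSet (x ⁻¹' S a) μ := hx.nullMeasurableSet_preimage (hS a)
  have hU : μ (⋃ a, x ⁻¹' S a) = 1 := by
    rw [measure_iUnion₀ (fun a b hab ↦ ((hSd hab).preimage x).aedisjoint) hnull, tsum_fintype,
      ← ENNReal.toReal_eq_one_iff, ENNReal.toReal_sum fun a _ ↦ measure_ne_top _ _]
    exact (Finset.sum_congr rfl fun a _ ↦ hxp a).trans hpsum
  have h := (prob_compl_eq_zero_iff₀ (NullMeasurableSet.iUnion hnull)).2 hU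
  filter_upwards [measure_eq_zero_iff_ae_notMem.1 h] with ω hω
  simpa using hω

/-- Almost surely `f ∘ x` is a simple function, so `f` itself needs no measurability. This makes the
characteristic function of one observation a finite sum. -/
lemma integral_of_const_on_states {F : Type*} [NormedAddCommGroup F] [NormedSpace ℝ F]
    [CompleteSpace F] (hS : ∀ a, MeasurableSet (S a))
    (hSd : Pairwise (fun a b ↦ Disjoint (S a) (S b))) (hpsum : ∑ a, p a = 1)
    (hx : AEMeasurable x μ) (hxp : ∀ a, μ.real (x ⁻¹' S a) = p a)
    {f : 𝓧 → F} {c : Fin k → F} (hf : ∀ a, ∀ y ∈ S a, f y = c a) :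
    ∫ ω, f (x ω) ∂μ = ∑ a, p a • c a := by
  have hnull (a : Fin k) : NullMeasurableSet (x ⁻¹' S a) μ := hx.nullMeasurableSet_preimage (hS a)
  have heq : (fun ω ↦ f (x ω)) =ᵐ[μ] fun ω ↦ ∑ a, (x ⁻¹' S a).indicator (fun _ ↦ c a) ω := by
    filter_upwards [ae_exists_mem_state hS hSd hpsum hx hxp] with ω ⟨a, ha⟩
    have ha' : ω ∈ x ⁻¹' S a := ha
    rw [Finset.sum_eq_single a, Set.indicator_of_mem ha', hf a _ ha]
    · intro b _ hb
      have hb' : ω ∉ x ⁻¹' S b := fun h ↦ (hSd hb).le_bot ⟨h, ha⟩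
      simp [Set.indicator_of_notMem hb']
    · simp
  rw [integral_congr_ae heq, integral_finsetSum _ fun a _ ↦
    (integrable_const (c a)).indicator₀ (hnull a)]
  refine Finset.sum_congr rfl fun a _ ↦ ?_
  rw [integral_indicator₀ (hnull a), setIntegral_const, hxp]

end Observation

lemma sum_empiricalProb {𝓧 : Type*} {k n : ℕ} {S : Fin k → Set 𝓧}
    (hSd : Pairwise (fun a b ↦ Disjoint (S a) (S b))) (hn : n ≠ 0)
    {x : Fin n → 𝓧} (hx : ∀ j, ∃ a, x j ∈ S a) : ∑ a, empiricalProb S x a = 1 := by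
  have h (j : Fin n) : ∑ a, (S a).indicator (fun _ ↦ (1 : ℝ)) (x j) = 1 := by
    obtain ⟨a, ha⟩ := hx j
    rw [Finset.sum_eq_single a, Set.indicator_of_mem ha]
    · intro b _ hb
      exact Set.indicator_of_notMem (fun h ↦ (hSd hb).le_bot ⟨h, ha⟩) _
    · simp
  simp_rw [empiricalProb, ← Finset.mul_sum]
  rw [Finset.sum_comm]
  simp [h, hn]

/-! ### Law of large numbers for the empirical probabilities. -/

section Empirical

variable {𝓧 Ω : Type*} [MeasurableSpace 𝓧] [MeasurableSpace Ω] {μ : Measure Ω}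
  [IsProbabilityMeasure μ] {k n : ℕ} {S : Fin k → Set 𝓧} {p : Fin k → ℝ}

lemma measurable_empiricalProb (hS : ∀ a, MeasurableSet (S a)) (a : Fin k) :
    Measurable fun x : Fin n → 𝓧 ↦ empiricalProb S x a := by
  refine Measurable.const_mul (Finset.measurable_fun_sum _ fun j _ ↦ ?_) _
  exact (measurable_const.indicator (hS a)).comp (measurable_pi_apply j)

/-- Chebyshev's inequality for the empirical probability of a state. -/
lemma measure_abs_empiricalProb_sub_ge_le (hS : ∀ a, MeasurableSet (S a)) {x : Fin n → Ω → 𝓧}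
    (hn : n ≠ 0) (hx : ∀ j, AEMeasurable (x j) μ) (hindep : iIndepFun x μ) {a : Fin k}
    (hxp : ∀ j, μ.real (x j ⁻¹' S a) = p a) {ε : ℝ} (hε : 0 < ε) :
    μ {ω | ε ≤ |empiricalProb S (fun j ↦ x j ω) a - p a|} ≤ ENNReal.ofReal (1 / n / ε ^ 2) := by
  have hn0 : (n : ℝ) ≠ 0 := by exact_mod_cast hn
  have hn1 : (0 : ℝ) < n := by positivity
  set g : 𝓧 → ℝ := (S a).indicator (fun _ ↦ (1 : ℝ))
  have hg : Measurable g := measurable_const.indicator (hS a)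
  have hg01 (y : 𝓧) : g y ∈ Set.Icc (0 : ℝ) 1 := by
    by_cases h : y ∈ S a <;> simp [g, h]
  have hY (j : Fin n) : AEMeasurable (g ∘ x j) μ := hg.comp_aemeasurable (hx j)
  have hmem (j : Fin n) : MemLp (g ∘ x j) 2 μ :=
    MemLp.of_bound (hY j).aestronglyMeasurable 1 (.of_forall fun ω ↦ by
      have := hg01 (x j ω)
      rw [Function.comp_apply, Real.norm_eq_abs, abs_of_nonneg this.1]
      exact this.2)
  have hmean (j : Fin n) : ∫ ω, (g ∘ x j) ω ∂μ = p a := by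
    have hnull : NullMeasurableSet (x j ⁻¹' S a) μ := (hx j).nullMeasurableSet_preimage (hS a)
    have : (g ∘ x j) = (x j ⁻¹' S a).indicator fun _ ↦ (1 : ℝ) := rfl
    rw [this, integral_indicator₀ hnull, setIntegral_const, hxp, smul_eq_mul, mul_one]
  -- A variable with values in `[0, 1]` has variance at most `1 / 4`; the cruder bound `1` suffices.
  have hvar (j : Fin n) : Var[g ∘ x j; μ] ≤ 1 := by
    refine (variance_le_sq_of_bounded (.of_forall fun ω ↦ hg01 (x j ω)) (hY j)).trans ?_
    norm_num
  have hsum : MemLp (∑ j, g ∘ x j) 2 μ := memLp_finsetSum' _ fun j _ ↦ hmem j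
  have hvarsum : Var[∑ j, g ∘ x j; μ] ≤ n := by
    rw [IndepFun.variance_sum (fun j _ ↦ hmem j)
      fun i _ j _ hij ↦ (hindep.indepFun hij).comp hg hg]
    exact (Finset.sum_le_sum fun j _ ↦ hvar j).trans (by simp)
  have hmeansum : ∫ ω, (∑ j, g ∘ x j) ω ∂μ = n * p a := by
    simp_rw [Finset.sum_apply]
    rw [integral_finsetSum _ fun j _ ↦ (hmem j).integrable (by norm_num)]
    simp_rw [hmean]
    simp
  have hch := meas_ge_le_variance_div_sq hsum (c := n * ε) (by positivity)
  rw [hmeansum] at hch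
  have hset : {ω | ε ≤ |empiricalProb S (fun j ↦ x j ω) a - p a|}
      = {ω | n * ε ≤ |(∑ j, g ∘ x j) ω - n * p a|} := by
    ext ω
    have : (∑ j, g ∘ x j) ω - n * p a = n * (empiricalProb S (fun j ↦ x j ω) a - p a) := by
      rw [Finset.sum_apply, empiricalProb]
      simp only [Function.comp_apply]
      field_simp
      rfl
    simp only [Set.mem_ofPred_eq]
    rw [this, abs_mul, abs_of_pos hn1, mul_le_mul_iff_right₀ hn1]
  rw [hset]
  refine hch.trans (ENNReal.ofReal_le_ofReal ?_)
  calc Var[∑ j, g ∘ x j; μ] / (n * ε) ^ 2 ≤ n / (n * ε) ^ 2 := by gcongr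
    _ = 1 / n / ε ^ 2 := by field_simp

end Empirical

/-- Weak law of large numbers for the empirical probabilities of triangular arrays. -/
lemma tendsto_measure_abs_empiricalProb_sub {𝓧 ι : Type*} [MeasurableSpace 𝓧] {l : Filter ι}
    {Ω : ι → Type*} [∀ t, MeasurableSpace (Ω t)] {μ : (t : ι) → Measure (Ω t)}
    [∀ t, IsProbabilityMeasure (μ t)] {k : ℕ} {S : Fin k → Set 𝓧} {p : Fin k → ℝ}
    (hS : ∀ a, MeasurableSet (S a)) {n : ι → ℕ} (hn : Tendsto n l atTop)
    {x : (t : ι) → Fin (n t) → Ω t → 𝓧} (hx : ∀ t j, AEMeasurable (x t j) (μ t))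
    (hindep : ∀ t, iIndepFun (x t) (μ t)) {a : Fin k}
    (hxp : ∀ t j, (μ t).real (x t j ⁻¹' S a) = p a) {ε : ℝ} (hε : 0 < ε) :
    Tendsto (fun t ↦ μ t {ω | ε ≤ |empiricalProb S (fun j ↦ x t j ω) a - p a|}) l (𝓝 0) := by
  have hlim : Tendsto (fun t ↦ ENNReal.ofReal (1 / (n t : ℝ) / ε ^ 2)) l (𝓝 0) := by
    have h1 : Tendsto (fun t ↦ 1 / (n t : ℝ) / ε ^ 2) l (𝓝 0) := by
      simpa using (tendsto_one_div_atTop_nhds_zero_nat.comp hn).div_const (ε ^ 2)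
    simpa using ENNReal.tendsto_ofReal h1
  refine tendsto_of_tendsto_of_tendsto_of_le_of_le' tendsto_const_nhds hlim
    (.of_forall fun _ ↦ zero_le) ?_
  filter_upwards [hn.eventually_ge_atTop 1] with t ht
  exact measure_abs_empiricalProb_sub_ge_le hS (by omega) (hx t) (hindep t) (hxp t) hε

/-! ### The standardised difference of the empirical probabilities -/

section Standardised

variable {𝓧 : Type*} {k : ℕ}

/-- The vector with components `(q a - p a) / √(p a)`, where `q` is the indicator vector of the
state that contains `y`. -/
noncomputable def standardisedState (S : Fin k → Set 𝓧) (p : Fin k → ℝ) (y : 𝓧) :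
    EuclideanSpace ℝ (Fin k) :=
  WithLp.toLp 2 fun a ↦ ((S a).indicator (fun _ ↦ (1 : ℝ)) y - p a) / √(p a)

/-- The standardised difference of the empirical probabilities of two samples. -/
noncomputable def standardisedDiff (S : Fin k → Set 𝓧) (p : Fin k → ℝ) (n m : ℕ)
    (x : Fin (n + m) → 𝓧) : EuclideanSpace ℝ (Fin k) :=
  √((n : ℝ) * m / (n + m)) • WithLp.toLp 2 fun a ↦
    (empiricalProb S (fun j : Fin n ↦ x (Fin.castAdd m j)) a
      - empiricalProb S (fun j : Fin m ↦ x (Fin.natAdd n j)) a) / √(p a)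

lemma measurable_standardisedState [MeasurableSpace 𝓧] {S : Fin k → Set 𝓧}
    (hS : ∀ a, MeasurableSet (S a)) (p : Fin k → ℝ) : Measurable (standardisedState S p) := by
  refine (WithLp.measurable_toLp 2 _).comp (measurable_pi_lambda _ fun a ↦ ?_)
  exact ((measurable_const.indicator (hS a)).sub_const _).div_const _

lemma measurable_standardisedDiff [MeasurableSpace 𝓧] {S : Fin k → Set 𝓧}
    (hS : ∀ a, MeasurableSet (S a)) (p : Fin k → ℝ) (n m : ℕ) :
    Measurable (standardisedDiff S p n m) := by
  have h : Measurable fun (x : Fin (n + m) → 𝓧) (a : Fin k) ↦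
      (empiricalProb S (fun j : Fin n ↦ x (Fin.castAdd m j)) a
        - empiricalProb S (fun j : Fin m ↦ x (Fin.natAdd n j)) a) / √(p a) := by
    refine measurable_pi_lambda _ fun a ↦ Measurable.div_const (.sub ?_ ?_) _
    · exact (measurable_empiricalProb hS a).comp
        (measurable_pi_lambda _ fun j ↦ measurable_pi_apply _)
    · exact (measurable_empiricalProb hS a).comp
        (measurable_pi_lambda _ fun j ↦ measurable_pi_apply _)
  exact ((WithLp.measurable_toLp 2 _).comp h).const_smul (√((n : ℝ) * m / (n + m)))

/-- The weight of an observation of the first or of the second sample in `standardisedDiff`. -/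
noncomputable def sampleWeight (n m : ℕ) : Fin (n + m) → ℝ :=
  Fin.append (fun _ : Fin n ↦ √((n : ℝ) * m / (n + m)) / n)
    (fun _ : Fin m ↦ -(√((n : ℝ) * m / (n + m)) / m))

/-- The weights of the two samples have opposite sums, so the centring by `p` cancels in the total
while making each summand centred. -/
lemma standardisedDiff_eq_sum (S : Fin k → Set 𝓧) (p : Fin k → ℝ) {n m : ℕ} (hn : n ≠ 0)
    (hm : m ≠ 0) (x : Fin (n + m) → 𝓧) :
    standardisedDiff S p n m x = ∑ j, sampleWeight n m j • standardisedState S p (x j) := by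
  have hn0 : (n : ℝ) ≠ 0 := by exact_mod_cast hn
  have hm0 : (m : ℝ) ≠ 0 := by exact_mod_cast hm
  ext a
  rw [Fin.sum_univ_add]
  simp only [sampleWeight, Fin.append_left, Fin.append_right, ← Finset.smul_sum, standardisedDiff,
    standardisedState, empiricalProb, PiLp.add_apply, PiLp.smul_apply, WithLp.ofLp_sum,
    Finset.sum_apply, smul_eq_mul, ← Finset.sum_div, Finset.sum_sub_distrib, Finset.sum_const,
    Finset.card_univ, Fintype.card_fin, nsmul_eq_mul]
  field_simp
  ring

/-- The inner product of `t` with `standardisedState` on the state `a`. -/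
noncomputable def stateScore (p : Fin k → ℝ) (t : EuclideanSpace ℝ (Fin k)) (a : Fin k) : ℝ :=
  t a / √(p a) - ∑ b, √(p b) * t b

lemma inner_standardisedState {S : Fin k → Set 𝓧}
    (hSd : Pairwise (fun a b ↦ Disjoint (S a) (S b))) {p : Fin k → ℝ}
    (t : EuclideanSpace ℝ (Fin k)) {a : Fin k} {y : 𝓧} (hy : y ∈ S a) :
    inner ℝ (standardisedState S p y) t = stateScore p t a := by
  simp only [standardisedState, PiLp.inner_apply, stateScore, sub_div, RCLike.inner_apply,
    conj_trivial, mul_sub, Finset.sum_sub_distrib]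
  congr 1
  · rw [Finset.sum_eq_single a, Set.indicator_of_mem hy]
    · ring
    · intro b _ hb
      rw [Set.indicator_of_notMem (fun h ↦ (hSd hb).le_bot ⟨h, hy⟩)]
      simp
    · simp
  · refine Finset.sum_congr rfl fun b _ ↦ ?_
    rw [Real.div_sqrt, mul_comm]

lemma sum_mul_stateScore {p : Fin k → ℝ} (hpsum : ∑ a, p a = 1)
    (t : EuclideanSpace ℝ (Fin k)) : ∑ a, p a * stateScore p t a = 0 := by
  have h (a : Fin k) : p a * (t a / √(p a)) = √(p a) * t a := by
    rw [← mul_div_assoc, mul_div_right_comm, Real.div_sqrt]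
  simp only [stateScore, mul_sub, Finset.sum_sub_distrib, h, ← Finset.sum_mul, hpsum, one_mul,
    sub_self]

/-- This is the quadratic form of the covariance `I - e eᵀ`, the same one as in
`charFun_map_subtype_stdGaussian_orthogonal`. -/
lemma sum_mul_stateScore_sq {p : Fin k → ℝ} (hp : ∀ a, 0 < p a) (hpsum : ∑ a, p a = 1)
    (t : EuclideanSpace ℝ (Fin k)) :
    ∑ a, p a * stateScore p t a ^ 2 = ‖t‖ ^ 2 - inner ℝ (WithLp.toLp 2 fun a ↦ √(p a)) t ^ 2 := by
  have hin : inner ℝ (WithLp.toLp 2 fun a ↦ √(p a)) t = ∑ b, √(p b) * t b := by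
    simp [PiLp.inner_apply, mul_comm]
  rw [hin, EuclideanSpace.real_norm_sq_eq]
  set c := ∑ b, √(p b) * t b with hc
  have h (a : Fin k) : p a * stateScore p t a ^ 2 = t a ^ 2 - 2 * c * (√(p a) * t a) + c ^ 2 * p a := by
    have h1 : √(p a) ≠ 0 := (Real.sqrt_pos.2 (hp a)).ne'
    have h2 : p a = √(p a) ^ 2 := (Real.sq_sqrt (hp a).le).symm
    rw [stateScore, ← hc]
    nth_rw 1 [h2]
    nth_rw 4 [h2]
    field_simp
    ring
  simp_rw [h, Finset.sum_add_distrib, Finset.sum_sub_distrib, ← Finset.mul_sum, ← hc, hpsum]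
  ring

variable {Ω : Type*} [MeasurableSpace 𝓧] [MeasurableSpace Ω] {μ : Measure Ω}
  [IsProbabilityMeasure μ]

lemma charFun_map_standardisedDiff {S : Fin k → Set 𝓧} (hS : ∀ a, MeasurableSet (S a))
    (hSd : Pairwise (fun a b ↦ Disjoint (S a) (S b))) {p : Fin k → ℝ}
    (hpsum : ∑ a, p a = 1) {n m : ℕ} (hn : n ≠ 0) (hm : m ≠ 0) {x : Fin (n + m) → Ω → 𝓧}
    (hx : ∀ j, AEMeasurable (x j) μ) (hindep : iIndepFun x μ)
    (hxp : ∀ j a, μ.real (x j ⁻¹' S a) = p a) (t : EuclideanSpace ℝ (Fin k)) :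
    charFun (μ.map fun ω ↦ standardisedDiff S p n m fun j ↦ x j ω) t =
      (∑ a, (p a : ℂ) * Complex.exp
        ((√((n : ℝ) * m / (n + m)) / n * stateScore p t a : ℝ) * Complex.I)) ^ n *
      (∑ a, (p a : ℂ) * Complex.exp
        ((-(√((n : ℝ) * m / (n + m)) / m) * stateScore p t a : ℝ) * Complex.I)) ^ m := by
  have hmeas (j : Fin (n + m)) :
      Measurable fun y ↦ sampleWeight n m j • standardisedState S p y :=
    (measurable_standardisedState hS p).const_smul (sampleWeight n m j)
  have hY (j : Fin (n + m)) :
      AEMeasurable (fun ω ↦ sampleWeight n m j • standardisedState S p (x j ω)) μ :=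
    (hmeas j).comp_aemeasurable (hx j)
  have hsum := iIndepFun.charFun_map_fun_sum_eq_prod hY (hindep.comp _ hmeas)
  simp_rw [standardisedDiff_eq_sum S p hn hm]
  rw [hsum, Finset.prod_apply]
  have hj (j : Fin (n + m)) :
      charFun (μ.map fun ω ↦ sampleWeight n m j • standardisedState S p (x j ω)) t =
        ∑ a, (p a : ℂ) * Complex.exp ((sampleWeight n m j * stateScore p t a : ℝ) * Complex.I) := by
    rw [charFun_apply, integral_map (hY j) (by fun_prop)]
    rw [integral_of_const_on_states hS hSd hpsum (hx j) (hxp j)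
      (f := fun y ↦ Complex.exp (inner ℝ (sampleWeight n m j • standardisedState S p y) t * Complex.I))
      (c := fun a ↦ Complex.exp ((sampleWeight n m j * stateScore p t a : ℝ) * Complex.I))]
    · simp
    · intro a y hy
      rw [real_inner_smul_left, inner_standardisedState hSd t hy]
  simp_rw [hj]
  rw [Fin.prod_univ_add]
  simp [sampleWeight]

end Standardised

/-! ### The two-sample statistic -/

section Statistic

variable {𝓧 : Type*} {k : ℕ}

lemma measurable_relEntropyTerm : Measurable fun z : ℝ × ℝ ↦ relEntropyTerm z.1 z.2 := by
  unfold relEntropyTerm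
  refine Measurable.ite (measurable_fst (measurableSet_singleton 0)) measurable_const ?_
  refine Measurable.ite (measurable_snd (measurableSet_singleton 0)) measurable_const ?_
  exact Measurable.coe_real_ereal (by fun_prop)

lemma measurable_twoSampleStat [MeasurableSpace 𝓧] {S : Fin k → Set 𝓧}
    (hS : ∀ a, MeasurableSet (S a)) (n m : ℕ) : Measurable (twoSampleStat S n m) := by
  have h : Measurable fun x : Fin (n + m) → 𝓧 ↦
      relEntropy (empiricalProb S (fun j : Fin n ↦ x (Fin.castAdd m j)))
        (empiricalProb S (fun j : Fin m ↦ x (Fin.natAdd n j))) := by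
    refine Finset.measurable_fun_sum _ fun a _ ↦ measurable_relEntropyTerm.comp (.prodMk ?_ ?_)
    · exact (measurable_empiricalProb hS a).comp
        (measurable_pi_lambda _ fun j ↦ measurable_pi_apply _)
    · exact (measurable_empiricalProb hS a).comp
        (measurable_pi_lambda _ fun j ↦ measurable_pi_apply _)
  exact measurable_const.mul h

lemma relEntropy_of_ne_zero {p q : Fin k → ℝ} (hq : ∀ a, q a ≠ 0) :
    relEntropy p q = ((∑ a, p a * Real.log (p a / q a) : ℝ) : EReal) := by
  have hterm (a : Fin k) :
      relEntropyTerm (p a) (q a) = ((p a * Real.log (p a / q a) : ℝ) : EReal) := by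
    by_cases h : p a = 0 <;> simp [relEntropyTerm, h, hq a]
  simp_rw [relEntropy, hterm]
  exact (map_sum (⟨⟨Real.toEReal, EReal.coe_zero⟩, EReal.coe_add⟩ : ℝ →+ EReal) _ _).symm

/-- The ratios of the terms of the relative entropy and of the chi-squared divergence. -/
noncomputable def stateRatio (S : Fin k → Set 𝓧) (p : Fin k → ℝ) (n m : ℕ)
    (x : Fin (n + m) → 𝓧) (a : Fin k) : ℝ :=
  entropyRatio (p a) (empiricalProb S (fun j : Fin n ↦ x (Fin.castAdd m j)) a,
    empiricalProb S (fun j : Fin m ↦ x (Fin.natAdd n j)) a)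

lemma measurable_stateRatio [MeasurableSpace 𝓧] {S : Fin k → Set 𝓧}
    (hS : ∀ a, MeasurableSet (S a)) (p : Fin k → ℝ) (n m : ℕ) :
    Measurable (stateRatio S p n m) := by
  refine measurable_pi_lambda _ fun a ↦ (measurable_entropyRatio (p a)).comp (.prodMk ?_ ?_)
  · exact (measurable_empiricalProb hS a).comp
      (measurable_pi_lambda _ fun j ↦ measurable_pi_apply _)
  · exact (measurable_empiricalProb hS a).comp
      (measurable_pi_lambda _ fun j ↦ measurable_pi_apply _)

/-- Both empirical vectors sum to one, so the corrections `-P a + Q a` add up to zero, and the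
factors `p a` in `W` and in the ratio cancel. -/
lemma twoSampleStat_eq_sum {S : Fin k → Set 𝓧} (hSd : Pairwise (fun a b ↦ Disjoint (S a) (S b)))
    {p : Fin k → ℝ} (hp : ∀ a, 0 < p a) {n m : ℕ} (hn : n ≠ 0) (hm : m ≠ 0)
    {x : Fin (n + m) → 𝓧} (hx : ∀ j, ∃ a, x j ∈ S a)
    (hq : ∀ a, empiricalProb S (fun j : Fin m ↦ x (Fin.natAdd n j)) a ≠ 0) :
    twoSampleStat S n m x =
      ((∑ a, standardisedDiff S p n m x a ^ 2 * stateRatio S p n m x a : ℝ) : EReal) := by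
  have hP := sum_empiricalProb hSd hn (x := fun j : Fin n ↦ x (Fin.castAdd m j)) fun j ↦ hx _
  have hQ := sum_empiricalProb hSd hm (x := fun j : Fin m ↦ x (Fin.natAdd n j)) fun j ↦ hx _
  rw [twoSampleStat, relEntropy_of_ne_zero hq, ← EReal.coe_mul]
  congr 1
  simp only [standardisedDiff, stateRatio, PiLp.smul_apply, smul_eq_mul]
  set P := empiricalProb S fun j : Fin n ↦ x (Fin.castAdd m j)
  set Q := empiricalProb S fun j : Fin m ↦ x (Fin.natAdd n j)
  have hc : (0 : ℝ) ≤ (n : ℝ) * m / (n + m) := by positivity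
  have hterm (a : Fin k) : (√((n : ℝ) * m / (n + m)) * ((P a - Q a) / √(p a))) ^ 2 *
      entropyRatio (p a) (P a, Q a) =
      (n : ℝ) * m / (n + m) * 2 * (P a * Real.log (P a / Q a) - P a + Q a) := by
    rw [mul_pow, div_pow, Real.sq_sqrt hc, Real.sq_sqrt (hp a).le, mul_assoc, mul_assoc,
      mul_log_div_sub_add_eq (P a) (hp a).ne' (hq a)]
  simp_rw [hterm, ← Finset.mul_sum, Finset.sum_add_distrib, Finset.sum_sub_distrib, hP, hQ]
  ring

end Statistic

/-! ### Limits in distribution along sequences. -/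

section Limit

variable {𝓧 : Type*} [MeasurableSpace 𝓧] {Ω : ℕ → Type*} [∀ t, MeasurableSpace (Ω t)]
  {μ : (t : ℕ) → Measure (Ω t)} [∀ t, IsProbabilityMeasure (μ t)] {k : ℕ} {S : Fin k → Set 𝓧}
  {p : Fin k → ℝ} {n m : ℕ → ℕ} {X : (t : ℕ) → Fin (n t + m t) → Ω t → 𝓧}

/-- The second order quotient is controlled only on a punctured neighbourhood of `0`; a nonzero
limit `v` keeps `u` eventually nonzero. -/
lemma tendsto_nhdsNE_zero_of_mul_sq {ι : Type*} {l : Filter ι} {N : ι → ℕ} {u : ι → ℝ} {v : ℝ}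
    (hN : Tendsto N l atTop) (hv : v ≠ 0)
    (hNu : Tendsto (fun t ↦ (N t : ℝ) * u t ^ 2) l (𝓝 v)) : Tendsto u l (𝓝[≠] 0) := by
  refine tendsto_nhdsWithin_iff.2 ⟨?_, ?_⟩
  · have h := hNu.mul (tendsto_inv_atTop_zero.comp (tendsto_natCast_atTop_atTop.comp hN))
    rw [mul_zero] at h
    have h2 : Tendsto (fun t ↦ u t ^ 2) l (𝓝 0) := by
      refine h.congr' ?_
      filter_upwards [hN.eventually_ge_atTop 1] with t ht
      have : (N t : ℝ) ≠ 0 := by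
        have : N t ≠ 0 := by omega
        exact_mod_cast this
      simp only [Function.comp_apply]
      field_simp
    rw [tendsto_zero_iff_abs_tendsto_zero]
    simpa [Function.comp_def, Real.sqrt_sq_eq_abs] using
      (Real.continuous_sqrt.tendsto 0).comp h2
  · filter_upwards [hNu.eventually_ne hv] with t ht h
    exact ht (by simp [Set.mem_singleton_iff.1 h])

/-- Central limit theorem for the difference of the empirical probabilities of two samples. -/
lemma tendstoInDistribution_standardisedDiff (hS : ∀ a, MeasurableSet (S a))
    (hSd : Pairwise (fun a b ↦ Disjoint (S a) (S b))) (hp : ∀ a, 0 < p a) (hpsum : ∑ a, p a = 1)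
    (hn : Tendsto n atTop atTop) (hm : Tendsto m atTop atTop) {lam : ℝ}
    (hlam : lam ∈ Set.Ioo (0 : ℝ) 1)
    (hratio : Tendsto (fun t ↦ (n t : ℝ) / ((n t : ℝ) + (m t : ℝ))) atTop (𝓝 lam))
    (hX : ∀ t j, AEMeasurable (X t j) (μ t)) (hindep : ∀ t, iIndepFun (X t) (μ t))
    (hXp : ∀ t j a, (μ t).real (X t j ⁻¹' S a) = p a) :
    TendstoInDistribution (fun t ω ↦ standardisedDiff S p (n t) (m t) fun j ↦ X t j ω) atTop
      (fun z : (Submodule.span ℝ {(WithLp.toLp 2 fun a ↦ √(p a) : EuclideanSpace ℝ (Fin k))})ᗮ ↦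
        (z : EuclideanSpace ℝ (Fin k))) μ (stdGaussian _) := by
  have hmeas (t : ℕ) :
      AEMeasurable (fun ω ↦ standardisedDiff S p (n t) (m t) fun j ↦ X t j ω) (μ t) :=
    (measurable_standardisedDiff hS p _ _).comp_aemeasurable (aemeasurable_pi_lambda _ (hX t))
  refine ⟨hmeas, by fun_prop, ProbabilityMeasure.tendsto_iff_tendsto_charFun.2 fun s ↦ ?_⟩
  have he : ‖(WithLp.toLp 2 fun a ↦ √(p a) : EuclideanSpace ℝ (Fin k))‖ = 1 := by
    rw [← sq_eq_sq₀ (norm_nonneg _) zero_le_one, EuclideanSpace.real_norm_sq_eq, one_pow, ← hpsum]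
    exact Finset.sum_congr rfl fun a _ ↦ Real.sq_sqrt (hp a).le
  have hpos : ∀ᶠ t in atTop, n t ≠ 0 ∧ m t ≠ 0 := by
    filter_upwards [hn.eventually_ge_atTop 1, hm.eventually_ge_atTop 1] with t h1 h2
    omega
  have hratio' : Tendsto (fun t ↦ (m t : ℝ) / ((n t : ℝ) + (m t : ℝ))) atTop (𝓝 (1 - lam)) := by
    refine (hratio.const_sub 1).congr' ?_
    filter_upwards [hpos] with t ht
    have h1 : (0 : ℝ) < n t := by exact_mod_cast Nat.pos_of_ne_zero ht.1
    field_simp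
    ring
  have hc (t : ℕ) : (0 : ℝ) ≤ (n t : ℝ) * m t / (n t + m t) := by positivity
  -- The squared weights of the first sample add up to `m / (n + m)`, those of the second to `n / (n
  -- + m)`.
  have hu : Tendsto (fun t ↦ (n t : ℝ) * (√((n t : ℝ) * m t / (n t + m t)) / n t) ^ 2) atTop
      (𝓝 (1 - lam)) := by
    refine hratio'.congr' ?_
    filter_upwards [hpos] with t ht
    have h1 : (0 : ℝ) < n t := by exact_mod_cast Nat.pos_of_ne_zero ht.1
    rw [div_pow, Real.sq_sqrt (hc t)]
    field_simp
  have hw : Tendsto (fun t ↦ (m t : ℝ) * (-(√((n t : ℝ) * m t / (n t + m t)) / m t)) ^ 2) atTop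
      (𝓝 lam) := by
    refine hratio.congr' ?_
    filter_upwards [hpos] with t ht
    have h1 : (0 : ℝ) < m t := by exact_mod_cast Nat.pos_of_ne_zero ht.2
    rw [neg_sq, div_pow, Real.sq_sqrt (hc t)]
    field_simp
  have hb := sum_mul_stateScore hpsum s
  have h1 := tendsto_sum_exp_pow hpsum hb
    (tendsto_nhdsNE_zero_of_mul_sq hn (by linarith [hlam.2]) hu) hu
  have h2 := tendsto_sum_exp_pow hpsum hb
    (tendsto_nhdsNE_zero_of_mul_sq hm hlam.1.ne' hw) hw
  have h := h1.mul h2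
  rw [← Complex.exp_add] at h
  have hlim : charFun ((stdGaussian (Submodule.span ℝ
      {(WithLp.toLp 2 fun a ↦ √(p a) : EuclideanSpace ℝ (Fin k))})ᗮ).map
        (fun z : (Submodule.span ℝ {(WithLp.toLp 2 fun a ↦ √(p a) : EuclideanSpace ℝ (Fin k))})ᗮ ↦
          (z : EuclideanSpace ℝ (Fin k)))) s =
      Complex.exp (-((1 - lam) * ∑ a, p a * stateScore p s a ^ 2 : ℝ) / 2 +
        -(lam * ∑ a, p a * stateScore p s a ^ 2 : ℝ) / 2) := by
    rw [charFun_map_subtype_stdGaussian_orthogonal he, ← sum_mul_stateScore_sq hp hpsum]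
    congr 1
    push_cast
    ring
  rw [← hlim] at h
  refine h.congr' ?_
  filter_upwards [hpos] with t ht
  exact (charFun_map_standardisedDiff hS hSd hpsum ht.1 ht.2 (hX t) (hindep t) (hXp t) s).symm

/-- By continuity of `entropyRatio` at `(p a, p a)`, a ratio far from `1` forces one of the two
empirical probabilities to be far from `p a`. -/
lemma tendsto_measure_norm_stateRatio_sub_one (hS : ∀ a, MeasurableSet (S a)) (hp : ∀ a, 0 < p a)
    (hn : Tendsto n atTop atTop) (hm : Tendsto m atTop atTop)
    (hX : ∀ t j, AEMeasurable (X t j) (μ t)) (hindep : ∀ t, iIndepFun (X t) (μ t))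
    (hXp : ∀ t j a, (μ t).real (X t j ⁻¹' S a) = p a) {ε : ℝ} (hε : 0 < ε) :
    Tendsto (fun t ↦ μ t {ω | ε ≤ ‖stateRatio S p (n t) (m t) (fun j ↦ X t j ω) - fun _ ↦ 1‖})
      atTop (𝓝 0) := by
  have hδ (a : Fin k) : ∃ δ > 0, ∀ z : ℝ × ℝ, dist z (p a, p a) < δ →
      ‖entropyRatio (p a) z - 1‖ < ε := by
    have h := Metric.continuousAt_iff.1 (continuousAt_entropyRatio (hp a).ne') ε hε
    simpa only [entropyRatio_self (hp a).ne', dist_eq_norm] using h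
  choose δ hδ0 hδ using hδ
  have hlim (a : Fin k) := (tendsto_measure_abs_empiricalProb_sub hS hn
      (x := fun t j ↦ X t (Fin.castAdd (m t) j)) (fun t j ↦ hX t _)
      (fun t ↦ (hindep t).precomp (Fin.castAdd_injective _ _)) (fun t j ↦ hXp t _ a) (hδ0 a)).add
    (tendsto_measure_abs_empiricalProb_sub hS hm
      (x := fun t j ↦ X t (Fin.natAdd (n t) j)) (fun t j ↦ hX t _)
      (fun t ↦ (hindep t).precomp (Fin.natAdd_injective _ _)) (fun t j ↦ hXp t _ a) (hδ0 a))
  have hsum := tendsto_finsetSum (Finset.univ : Finset (Fin k)) fun a _ ↦ hlim a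
  simp only [add_zero, Finset.sum_const_zero] at hsum
  refine tendsto_of_tendsto_of_tendsto_of_le_of_le tendsto_const_nhds hsum (fun _ ↦ zero_le)
    fun t ↦ ?_
  refine le_trans (measure_mono ?_) ((measure_iUnion_fintype_le (μ t) _).trans
    (Finset.sum_le_sum fun a _ ↦ measure_union_le _ _))
  intro ω hω
  by_contra hcon
  simp only [Set.mem_iUnion, Set.mem_union, Set.mem_ofPred_eq, not_exists, not_or, not_le] at hcon
  refine (not_lt.2 (Set.mem_ofPred_eq ▸ hω : ε ≤ _)) ((pi_norm_lt_iff hε).2 fun a ↦ ?_)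
  refine hδ a _ ?_
  rw [Prod.dist_eq, Real.dist_eq, Real.dist_eq]
  exact max_lt (hcon a).1 (hcon a).2

/-- The two-sample statistic is a chi-squared type statistic up to an event of vanishing
probability. -/
lemma tendsto_measureReal_sum_ne_twoSampleStat (hS : ∀ a, MeasurableSet (S a))
    (hSd : Pairwise (fun a b ↦ Disjoint (S a) (S b))) (hp : ∀ a, 0 < p a) (hpsum : ∑ a, p a = 1)
    (hn : Tendsto n atTop atTop) (hm : Tendsto m atTop atTop)
    (hX : ∀ t j, AEMeasurable (X t j) (μ t)) (hindep : ∀ t, iIndepFun (X t) (μ t))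
    (hXp : ∀ t j a, (μ t).real (X t j ⁻¹' S a) = p a) :
    Tendsto (fun t ↦ (μ t).real {ω |
      ((∑ a, standardisedDiff S p (n t) (m t) (fun j ↦ X t j ω) a ^ 2 *
        stateRatio S p (n t) (m t) (fun j ↦ X t j ω) a : ℝ) : EReal) ≠
      twoSampleStat S (n t) (m t) fun j ↦ X t j ω}) atTop (𝓝 0) := by
  -- The radius is `p a` itself: `Q a = 0` is a deviation of exactly that size.
  have hlim (a : Fin k) := tendsto_measure_abs_empiricalProb_sub hS hm
      (x := fun t j ↦ X t (Fin.natAdd (n t) j)) (fun t j ↦ hX t _)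
      (fun t ↦ (hindep t).precomp (Fin.natAdd_injective _ _)) (fun t j ↦ hXp t _ a) (hp a)
  have hsum := tendsto_finsetSum (Finset.univ : Finset (Fin k)) fun a _ ↦ hlim a
  simp only [Finset.sum_const_zero] at hsum
  have key := (ENNReal.tendsto_toReal ENNReal.zero_ne_top).comp
    (tendsto_of_tendsto_of_tendsto_of_le_of_le' tendsto_const_nhds hsum
      (f := fun t ↦ μ t {ω |
        ((∑ a, standardisedDiff S p (n t) (m t) (fun j ↦ X t j ω) a ^ 2 *
          stateRatio S p (n t) (m t) (fun j ↦ X t j ω) a : ℝ) : EReal) ≠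
        twoSampleStat S (n t) (m t) fun j ↦ X t j ω}) (.of_forall fun _ ↦ zero_le) ?_)
  · simpa [measureReal_def, Function.comp_def] using key
  filter_upwards [hn.eventually_ge_atTop 1, hm.eventually_ge_atTop 1] with t h1 h2
  refine le_trans (measure_mono_ae ?_) (measure_iUnion_fintype_le (μ t) _)
  have hcover : ∀ᵐ ω ∂μ t, ∀ j, ∃ a, X t j ω ∈ S a :=
    ae_all_iff.2 fun j ↦ ae_exists_mem_state hS hSd hpsum (hX t j) (hXp t j)
  filter_upwards [hcover] with ω hω hne
  by_contra hcon
  refine hne (twoSampleStat_eq_sum hSd hp (by omega) (by omega) hω fun a ha ↦ hcon ?_).symm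
  refine Set.mem_iUnion.2 ⟨a, ?_⟩
  rw [Set.mem_ofPred_eq, ha, zero_sub, abs_neg, abs_of_pos (hp a)]

lemma tendstoInDistribution_twoSampleStat (hS : ∀ a, MeasurableSet (S a))
    (hSd : Pairwise (fun a b ↦ Disjoint (S a) (S b))) (hp : ∀ a, 0 < p a) (hpsum : ∑ a, p a = 1)
    (hn : Tendsto n atTop atTop) (hm : Tendsto m atTop atTop) {lam : ℝ}
    (hlam : lam ∈ Set.Ioo (0 : ℝ) 1)
    (hratio : Tendsto (fun t ↦ (n t : ℝ) / ((n t : ℝ) + (m t : ℝ))) atTop (𝓝 lam))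
    (hX : ∀ t j, AEMeasurable (X t j) (μ t)) (hindep : ∀ t, iIndepFun (X t) (μ t))
    (hXp : ∀ t j a, (μ t).real (X t j ⁻¹' S a) = p a) :
    TendstoInDistribution (fun t ω ↦ twoSampleStat S (n t) (m t) fun j ↦ X t j ω) atTop
      (fun z : (Submodule.span ℝ {(WithLp.toLp 2 fun a ↦ √(p a) : EuclideanSpace ℝ (Fin k))})ᗮ ↦
        ((‖z‖ ^ 2 : ℝ) : EReal)) μ (stdGaussian _) := by
  have hW := tendstoInDistribution_standardisedDiff hS hSd hp hpsum hn hm hlam hratio hX hindep hXp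
  have hg : Continuous fun z : EuclideanSpace ℝ (Fin k) × (Fin k → ℝ) ↦
      ((∑ a, z.1 a ^ 2 * z.2 a : ℝ) : EReal) :=
    continuous_coe_real_ereal.comp (by fun_prop)
  have hT := hW.continuous_comp_prodMk_of_tendsto_const hg
    (Y := fun t ω ↦ stateRatio S p (n t) (m t) fun j ↦ X t j ω) (c := fun _ ↦ 1)
    (fun t ↦ (measurable_stateRatio hS p _ _).comp_aemeasurable (aemeasurable_pi_lambda _ (hX t)))
    fun ε hε ↦ tendsto_measure_norm_stateRatio_sub_one hS hp hn hm hX hindep hXp hε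
  have hT' := hT.congr_of_tendsto_measure_ne
    (fun t ↦ (measurable_twoSampleStat hS _ _).comp_aemeasurable (aemeasurable_pi_lambda _ (hX t)))
    (tendsto_measureReal_sum_ne_twoSampleStat hS hSd hp hpsum hn hm hX hindep hXp)
  refine hT'.congr (fun _ ↦ .rfl) (.of_forall fun z ↦ ?_)
  simp only [mul_one]
  rw [← EuclideanSpace.real_norm_sq_eq]
  rfl

end Limit

theorem theorem2 {𝓧 : Type*} [MeasurableSpace 𝓧]
    -- the `k` states, and the probability vector `p ∈ (0,1)^k`
    {k : ℕ} (hk : 2 ≤ k) (S : Fin k → Set 𝓧) (hSmeas : ∀ a, MeasurableSet (S a))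
    (hSdisj : Pairwise (fun a b ↦ Disjoint (S a) (S b)))
    (p : Fin k → ℝ) (hp : ∀ a, p a ∈ Set.Ioo (0 : ℝ) 1) (hpsum : ∑ a, p a = 1)
    -- the sample sizes: `n → ∞`, `m → ∞`, `n / (n + m) → lam ∈ (0,1)`
    {ι : Type*} {l : Filter ι} (n m : ι → ℕ)
    (hn : Tendsto n l atTop) (hm : Tendsto m l atTop)
    (lam : ℝ) (hlam : lam ∈ Set.Ioo (0 : ℝ) 1)
    (hratio : Tendsto (fun t ↦ (n t : ℝ) / ((n t : ℝ) + (m t : ℝ))) l (𝓝 lam))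
    -- the `n + m` iid observations
    {Ω : ι → Type*} [∀ t, MeasurableSpace (Ω t)]
    (μ : (t : ι) → Measure (Ω t)) [∀ t, IsProbabilityMeasure (μ t)]
    (X : (t : ι) → Fin (n t + m t) → Ω t → 𝓧)
    (hindep : ∀ t, iIndepFun (X t) (μ t))
    (hident : ∀ t i j, IdentDistrib (X t i) (X t j) (μ t) (μ t))
    (hXp : ∀ t j a, (μ t).real (X t j ⁻¹' S a) = p a)
    -- a random variable with the chi-squared distribution with `k - 1` degrees of freedom
    {Ω' : Type*} [MeasurableSpace Ω'] (μ' : Measure Ω') [IsProbabilityMeasure μ']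
    (Z : Ω' → ℝ) (hZ : HasLaw Z (chiSquared (k - 1)) μ') :
    TendstoInDistribution (fun t ω ↦ twoSampleStat S (n t) (m t) (fun j ↦ X t j ω)) l
      (fun ω ↦ ((Z ω : ℝ) : EReal)) μ μ' := by
  have hX (t : ι) (j : Fin (n t + m t)) : AEMeasurable (X t j) (μ t) :=
    (hident t j j).aemeasurable_fst
  have hp0 (a : Fin k) : 0 < p a := (hp a).1
  have hmeas (t : ι) :
      AEMeasurable (fun ω ↦ twoSampleStat S (n t) (m t) fun j ↦ X t j ω) (μ t) :=
    (measurable_twoSampleStat hSmeas _ _).comp_aemeasurable (aemeasurable_pi_lambda _ (hX t))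
  have hZm : AEMeasurable (fun ω ↦ ((Z ω : ℝ) : EReal)) μ' := hZ.aemeasurable.coe_real_ereal
  set e : EuclideanSpace ℝ (Fin k) := WithLp.toLp 2 fun a ↦ √(p a) with he
  have he0 : e ≠ 0 := by
    intro h
    have : e ⟨0, by omega⟩ = 0 := by rw [h]; rfl
    exact (Real.sqrt_pos.2 (hp0 _)).ne' this
  have hrank : Module.finrank ℝ (Submodule.span ℝ {e})ᗮ = k - 1 := by
    -- The hypothesis `2 ≤ k` ensures that the truncated subtraction satisfies `k - 1 + 1 = k`.
    have : Fact (Module.finrank ℝ (EuclideanSpace ℝ (Fin k)) = k - 1 + 1) :=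
      ⟨by rw [finrank_euclideanSpace_fin]; omega⟩
    exact Submodule.finrank_orthogonal_span_singleton he0
  have hlaw : (stdGaussian (Submodule.span ℝ {e})ᗮ).map (fun z ↦ ((‖z‖ ^ 2 : ℝ) : EReal))
      = μ'.map fun ω ↦ ((Z ω : ℝ) : EReal) := by
    have h1 := Measure.map_map (μ := stdGaussian (Submodule.span ℝ {e})ᗮ)
      measurable_coe_real_ereal (f := fun z ↦ ‖z‖ ^ 2) (by fun_prop)
    have h2 := AEMeasurable.map_map_of_aemeasurable (μ := μ')
      measurable_coe_real_ereal.aemeasurable hZ.aemeasurable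
    rw [map_norm_sq_stdGaussian, hrank, ← hZ.map_eq, h2] at h1
    exact h1.symm
  -- the filter `l` may be replaced by a countably generated one
  set l' : Filter ι := comap n atTop ⊓ comap m atTop ⊓
    comap (fun t ↦ (n t : ℝ) / ((n t : ℝ) + (m t : ℝ))) (𝓝 lam)
  have hl : l ≤ l' := le_inf (le_inf hn.le_comap hm.le_comap) hratio.le_comap
  refine ⟨hmeas, hZm, Tendsto.mono_left ?_ hl⟩
  -- Convergence along a countably generated filter can be tested on sequences, which reduces an
  -- arbitrary index filter to `atTop` on `ℕ`.
  refine tendsto_of_seq_tendsto fun x hx ↦ ?_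
  have hx1 : Tendsto (n ∘ x) atTop atTop := tendsto_comap.comp
    (hx.mono_right (inf_le_left.trans inf_le_left))
  have hx2 : Tendsto (m ∘ x) atTop atTop := tendsto_comap.comp
    (hx.mono_right (inf_le_left.trans inf_le_right))
  have hx3 := tendsto_comap.comp (hx.mono_right inf_le_right)
  have h := tendstoInDistribution_twoSampleStat (μ := fun t ↦ μ (x t)) (X := fun t ↦ X (x t))
    hSmeas hSdisj hp0 hpsum hx1 hx2 hlam hx3 (fun t ↦ hX (x t)) (fun t ↦ hindep (x t))
    (fun t ↦ hXp (x t))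
  convert! h.tendsto using 2
  exact congrArg 𝓝 (Subtype.ext hlaw.symm)
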